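/- Let $0\le q\le r\le m$ be integers and let $S=\{1,\dots,m\}$. Index $2^m$ qubits by the vertices of the hypercube $\mathbb{Z}_2^m$. For $J\subseteq S$ let $\langle J\rangle\subseteq\mathbb{Z}_2^m$ be the set of bit strings supported in $J$, and let $e_J$ be the incidence vector of $J$. A $d$-cube is a set $x+\langle J\rangle$ with $|J|=d$. For a single-qubit operator $U$ and $A\subseteq\mathbb{Z}_2^m$, let $U_A$ act as $U$ on the qubits in $A$ and as the identity elsewhere. The quantum Reed--Muller code $QRM_m(q,r)$ is the common $+1$ eigenspace of the operators $X_A$, $A$ an $(m-q)$-cube, and $Z_A$, $A$ an $(r+1)$-cube. Its logical qubits are indexed by $\mathcal{Q}=\{J\subseteq S : q+1\le |J|\le r\}$, with logical Pauli operators $\overline Z_J=Z_{\langle J\rangle}$ and $\overline X_J=X_{e_J+\langle S\setminus J\rangle}$. For $k\ge 0$ let $Z(k)=|0\rangle\langle 0|+e^{i\pi/2^k}|1\rangle\langle 1|$. The unsigned operator $Z(k)_A$ is as above; the signed operator $\widetilde Z(k)_A$ acts as $Z(k)$ on the qubits of $A$ of even Hamming weight, as $Z(k)^\dagger$ on the qubits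 of $A$ of odd Hamming weight, and as the identity elsewhere. Operators $U,V$ are logically equivalent, $U\equiv V$, if $U|\psi\rangle=V|\psi\rangle$ for every $|\psi\rangle\in QRM_m(q,r)$. An operator $U$ implements an operator $G$ on $|\mathcal{Q}|$ qubits if $UE=EG$ for an isometry $E$ from the space of $|\mathcal{Q}|$ qubits onto $QRM_m(q,r)$ with $\overline Z_JE=EZ_J$ and $\overline X_JE=EX_J$ for all $J\in\mathcal{Q}$ (such an $E$ is unique up to a global phase). Let $\mathcal{Q}_k=\{K\subseteq S : q+kr+1\le |K|\le (k+1)r\}$. For $K\in\mathcal{Q}_k$ let $\mathcal{F}(K)$ be the collection of all $\mathcal{J}\subseteq\mathcal{Q}$ with $|\mathcal{J}|=k+1$ and $\bigcup_{J\in\mathcal{J}}J=K$. Let $C^{\mathcal{F}(K)}Z$ be the product, over $\mathcal{J}\in\mathcal{F}(K)$, of the multi-controlled-$Z$ gates on the qubits in $\mathcal{J}$, where the gate for $\mathcal{J}$ multiplies by $-1$ the computational basis states that are $1$ on all qubits of $\mathcal{J}$ and fixes the others. **Theorem.** Let $K\in\mathcal{Q}_k$. 1. If $q\ge 1$, then $Z(k)_{\langle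 K\rangle}\equiv\widetilde Z(k)_{\langle K\rangle}$. 2. If $|K|\ge q+kr+2$, then $Z(k)_{\langle K\rangle}\equiv\widetilde Z(k)_{\langle K\rangle}$. In particular, if $q\ge 1$, then $Z(k)_{\langle K\rangle}$ implements $C^{\mathcal{F}(K)}Z$. -/

import Mathlib

open scoped Matrix

noncomputable section

namespace QRM

/-! ### Qubits and tensor-product operators

The state space of qubits indexed by a finite type `ι` is `(ι → Fin 2) → ℂ`; the basis vector
labelled by `f : ι → Fin 2` is the computational basis state `|f⟩`. -/

/-- Operators on the qubits indexed by `ι`, in the computational basis. -/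
abbrev Op (ι : Type) : Type := Matrix (ι → Fin 2) (ι → Fin 2) ℂ

/-- The tensor product `⨂ x, U x` of single-qubit operators. -/
def tensorOp {ι : Type} [Fintype ι] (U : ι → Matrix (Fin 2) (Fin 2) ℂ) : Op ι :=
  Matrix.of fun f g => ∏ x, U x (f x) (g x)

/-- The operator `U_A` which acts as `U` on the qubits in `A` and as the identity elsewhere. -/
def onSet {ι : Type} [Fintype ι] [DecidableEq ι] (U : Matrix (Fin 2) (Fin 2) ℂ)
    (A : Finset ι) : Op ι :=
  tensorOp fun x => if x ∈ A then U else 1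

/-- The Pauli matrix `X`. -/
def pauliX : Matrix (Fin 2) (Fin 2) ℂ := !![0, 1; 1, 0]

/-- The Pauli matrix `Z`. -/
def pauliZ : Matrix (Fin 2) (Fin 2) ℂ := !![1, 0; 0, -1]

/-- The rotation `Z(k) = |0⟩⟨0| + exp(iπ/2^k) |1⟩⟨1|`. -/
def rotZ (k : ℕ) : Matrix (Fin 2) (Fin 2) ℂ :=
  !![1, 0; 0, Complex.exp (Complex.I * (Real.pi : ℂ) / 2 ^ k)]

/-- The multi-controlled `Z` gate on the set of qubits `I`: it multiplies by `-1` the computational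
basis states which are `1` on all of `I`, and fixes the others.  It is the identity if `I = ∅`. -/
def controlledZ {ι : Type} [Fintype ι] [DecidableEq ι] (I : Finset ι) : Op ι :=
  Matrix.diagonal fun b => if I.Nonempty ∧ ∀ i ∈ I, b i = 1 then -1 else 1

theorem controlledZ_pairwise_commute {ι : Type} [Fintype ι] [DecidableEq ι]
    (F : Finset (Finset ι)) :
    (F : Set (Finset ι)).Pairwise (Function.onFun Commute controlledZ) := by
  intro I _ J _ _
  exact Matrix.commute_diagonal _ _

/-- The circuit made of one gate `controlledZ I` for each `I ∈ F` (these gates commute). -/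
def controlledZCircuit {ι : Type} [Fintype ι] [DecidableEq ι] (F : Finset (Finset ι)) : Op ι :=
  F.noncommProd controlledZ (controlledZ_pairwise_commute F)

/-! ### The hypercube and its subcubes -/

/-- The vertices of the `m`-dimensional hypercube. -/
abbrev Cube (m : ℕ) : Type := Fin m → ZMod 2

/-- The standard subcube `⟨J⟩`: the bit strings supported in `J`. -/
def stdCube {m : ℕ} (J : Finset (Fin m)) : Finset (Cube m) :=
  Finset.univ.filter fun x => ∀ i, i ∉ J → x i = 0

/-- The subcube `x + ⟨J⟩`. -/
def coset {m : ℕ} (x : Cube m) (J : Finset (Fin m)) : Finset (Cube m) :=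
  (stdCube J).image fun y => x + y

/-- The incidence bit string `e_J` of `J`. -/
def incidence {m : ℕ} (J : Finset (Fin m)) : Cube m := fun i => if i ∈ J then 1 else 0

/-- `A` is a subcube of dimension `d`. -/
def IsSubcube {m : ℕ} (d : ℕ) (A : Finset (Cube m)) : Prop :=
  ∃ (x : Cube m) (J : Finset (Fin m)), J.card = d ∧ A = coset x J

/-- The signed operator `Z̃(k)_A`: it acts as `Z(k)` on the qubits of `A` of even Hamming weight, as
`Z(k)†` on those of odd Hamming weight, and as the identity elsewhere. -/
def signedRotZ {m : ℕ} (k : ℕ) (A : Finset (Cube m)) : Op (Cube m) :=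
  tensorOp fun x => if x ∈ A then (if Even (hammingNorm x) then rotZ k else (rotZ k)ᴴ) else 1

/-- The unsigned operator `Z(k)_A`. -/
def unsignedRotZ {m : ℕ} (k : ℕ) (A : Finset (Cube m)) : Op (Cube m) := onSet (rotZ k) A

/-! ### The quantum Reed-Muller code -/

/-- The code space of `QRM_m(q, r)`: the joint `+1` eigenspace of the `X` operators on
`(m - q)`-dimensional subcubes and of the `Z` operators on `(r + 1)`-dimensional subcubes. -/
def codeSpace (m q r : ℕ) : Set ((Cube m → Fin 2) → ℂ) :=
  {ψ | (∀ A : Finset (Cube m), IsSubcube (m - q) A → onSet pauliX A *ᵥ ψ = ψ) ∧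
       (∀ A : Finset (Cube m), IsSubcube (r + 1) A → onSet pauliZ A *ᵥ ψ = ψ)}

/-- `U` and `V` are logically equivalent on `QRM_m(q, r)`: they act identically on code states. -/
def LogicallyEquivalent (m q r : ℕ) (U V : Op (Cube m)) : Prop :=
  ∀ ψ ∈ codeSpace m q r, U *ᵥ ψ = V *ᵥ ψ

/-- The index set `𝒬` of the logical qubits of `QRM_m(q, r)`. -/
abbrev LogicalQubit (m q r : ℕ) : Type :=
  {J : Finset (Fin m) // q + 1 ≤ J.card ∧ J.card ≤ r}

/-- The logical Pauli operator `Z` of the `J`-th logical qubit, `Z_⟨J⟩`. -/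
def logicalZ {m q r : ℕ} (J : LogicalQubit m q r) : Op (Cube m) :=
  onSet pauliZ (stdCube J.1)

/-- The logical Pauli operator `X` of the `J`-th logical qubit, `X_{e_J + ⟨S ∖ J⟩}`. -/
def logicalX {m q r : ℕ} (J : LogicalQubit m q r) : Op (Cube m) :=
  onSet pauliX (coset (incidence J.1) (J.1)ᶜ)

/-- `E` is an encoder: an isometry from the register of logical qubits onto the code space which
carries the Pauli operators of the `J`-th qubit of the register to the `J`-th logical Pauli
operators.  These conditions determine `E` up to a global phase. -/
structure IsEncoder (m q r : ℕ)
    (E : Matrix (Cube m → Fin 2) (LogicalQubit m q r → Fin 2) ℂ) : Prop where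
  isometry : Eᴴ * E = 1
  range_eq : Set.range (fun φ : (LogicalQubit m q r → Fin 2) → ℂ => E *ᵥ φ) = codeSpace m q r
  map_Z : ∀ J : LogicalQubit m q r, logicalZ J * E = E * onSet pauliZ {J}
  map_X : ∀ J : LogicalQubit m q r, logicalX J * E = E * onSet pauliX {J}

/-- The physical operator `U` implements the operator `G` on the logical qubits of `QRM_m(q, r)`. -/
def Implements (m q r : ℕ) (U : Op (Cube m)) (G : Op (LogicalQubit m q r)) : Prop :=
  ∃ E : Matrix (Cube m → Fin 2) (LogicalQubit m q r → Fin 2) ℂ,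
    IsEncoder m q r E ∧ U * E = E * G

/-- The index set `𝒬_k` for the `k`-th level logical operators of `QRM_m(q, r)`. -/
def levelIndexSet (m q r k : ℕ) : Set (Finset (Fin m)) :=
  {K | q + k * r + 1 ≤ K.card ∧ K.card ≤ (k + 1) * r}

/-- The collection `ℱ(K)` of minimal covers of `K ∈ 𝒬_k`: the sets of `k + 1` logical qubits whose
index sets have union `K`. -/
def minimalCovers (m q r k : ℕ) (K : Finset (Fin m)) : Finset (Finset (LogicalQubit m q r)) :=
  Finset.univ.filter fun 𝒥 => (𝒥.biUnion fun J => J.1) = K ∧ 𝒥.card = k + 1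

end QRM

end

noncomputable section

namespace QRM

open scoped Fin.CommRing

/-! Label the physical basis states by functions `f` on the hypercube with values in the two-element
field. The X stabilizers say that a code state is invariant under translation by functions of degree
at most `q`; the Z stabilizers say that it is supported on functions of degree at most `r`
(`mem_codeSpace_iff`). So the logical basis states are uniform superpositions over cosets of one
Reed-Muller code in the other, and the logical bits are the algebraic normal form coefficients of
degree between `q + 1` and `r`.

Both rotations are diagonal: on `f` their phase is a primitive `2 ^ (k + 1)`-th root of unity raised
to a weighted count of `f` over `⟨K⟩`, with weights `1` or `(-1) ^ |x|`. Only these counts modulo `2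
^ (k + 1)` on functions of degree at most `r` matter. Writing `(-1) ^ f` as the product of the
factors `1 - 2 * monomial` and expanding, a family of `j` monomials with union `L ⊆ K` contributes a
multiple of `2 ^ (j + |K| - |L|)`, where `|L| ≤ j * r`. If `|K| ≥ k * r + 2`, modulo `2 ^ (k + 2)`
only the families of `k + 1` monomials with union exactly `K` survive, each contributing `2 ^ (k +
1)` for either weight (`weighted_sum_intSign_modEq`). Hence both phases are `-1` to the number of
such covers. If moreover `|K| ≥ q + k * r + 1`, every monomial in a cover has degree above `q`, so
the covers are sets of logical qubits (`card_minimalCovers_filter`), which gives the circuit. -/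

instance : CharP (Fin 2) 2 := inferInstanceAs (CharP (ZMod 2) 2)

variable {m : ℕ}

/-! ### Sums over subcubes -/

theorem mem_stdCube {J : Finset (Fin m)} {x : Cube m} :
    x ∈ stdCube J ↔ ∀ i, i ∉ J → x i = 0 := by
  simp [stdCube]

theorem mem_coset {J : Finset (Fin m)} {x y : Cube m} :
    y ∈ coset x J ↔ ∀ i, i ∉ J → y i = x i := by
  simp only [coset, Finset.mem_image, mem_stdCube]
  constructor
  · rintro ⟨z, hz, rfl⟩ i hi
    simp [hz i hi]
  · intro h
    exact ⟨y - x, fun i hi => by simp [h i hi], by simp⟩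

theorem coset_zero (J : Finset (Fin m)) : coset 0 J = stdCube J := by
  ext y
  simp [mem_coset, mem_stdCube]

/-- Flipping the `i`-th bit. -/
def flip (i : Fin m) (x : Cube m) : Cube m := x + Pi.single i 1

theorem flip_same (i : Fin m) (x : Cube m) : flip i x i = x i + 1 := by simp [flip]

theorem flip_of_ne {i j : Fin m} (h : j ≠ i) (x : Cube m) : flip i x j = x j := by
  simp [flip, h]

theorem flip_flip (i : Fin m) (x : Cube m) : flip i (flip i x) = x := by
  rw [flip, flip, add_assoc, ← Pi.single_add, CharTwo.add_self_eq_zero, Pi.single_zero, add_zero]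

theorem flip_ne (i : Fin m) (x : Cube m) : flip i x ≠ x := by
  simp [flip]

theorem flip_mem_coset {i : Fin m} {J : Finset (Fin m)} (hi : i ∈ J) {x y : Cube m}
    (hy : y ∈ coset x J) : flip i y ∈ coset x J := by
  rw [mem_coset] at hy ⊢
  intro j hj
  rw [flip_of_ne (by rintro rfl; exact hj hi), hy j hj]

theorem sum_coset_eq_zero_of_flip {i : Fin m} {J : Finset (Fin m)} (hi : i ∈ J) (x : Cube m)
    {g : Cube m → Fin 2} (hg : ∀ y, g (flip i y) = g y) : ∑ y ∈ coset x J, g y = 0 :=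
  Finset.sum_involution (fun y _ => flip i y)
    (fun y _ => by rw [hg]; exact CharTwo.add_self_eq_zero _)
    (fun y _ _ => flip_ne i y) (fun y hy => flip_mem_coset hi hy) (fun y _ => flip_flip i y)

/-- The indicator function of a set of vertices. -/
def indicator {ι : Type} [DecidableEq ι] (A : Finset ι) : ι → Fin 2 :=
  fun x => if x ∈ A then 1 else 0

theorem indicator_coset_insert {i : Fin m} {J : Finset (Fin m)} (hi : i ∉ J) (x : Cube m) :
    indicator (coset x (insert i J)) =
      indicator (coset x J) + indicator (coset (flip i x) J) := by
  funext y
  simp only [indicator, Pi.add_apply]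
  have h1 : y ∈ coset x (insert i J) ↔ ∀ j, j ∉ J → j ≠ i → y j = x j := by
    rw [mem_coset]
    exact forall_congr' fun j => by rw [Finset.mem_insert]; tauto
  have h2 : y ∈ coset x J ↔ y ∈ coset x (insert i J) ∧ y i = x i := by
    rw [h1, mem_coset]
    refine ⟨fun h => ⟨fun j hj _ => h j hj, h i hi⟩, fun h j hj => ?_⟩
    by_cases hji : j = i
    · exact hji ▸ h.2
    · exact h.1 j hj hji
  have h3 : y ∈ coset (flip i x) J ↔ y ∈ coset x (insert i J) ∧ y i = x i + 1 := by
    rw [h1, mem_coset]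
    refine ⟨fun h => ⟨fun j hj hji => by rw [h j hj, flip_of_ne hji],
      by rw [h i hi, flip_same]⟩, fun h j hj => ?_⟩
    by_cases hji : j = i
    · subst hji; rw [h.2, flip_same]
    · rw [flip_of_ne hji, h.1 j hj hji]
  simp only [h2, h3]
  by_cases h : y ∈ coset x (insert i J)
  · simp only [h, true_and, if_true]
    generalize y i = a
    generalize x i = b
    revert a b
    decide
  · simp [h]

/-- Halving along one direction writes a large cube as a sum of two smaller ones, so the generators
of the exact dimension `d` suffice. -/
theorem indicator_mem_of_subcube {d : ℕ} (N : AddSubgroup (Cube m → Fin 2))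
    (hN : ∀ A, IsSubcube d A → indicator A ∈ N) (J : Finset (Fin m)) (hJ : d ≤ J.card)
    (x : Cube m) : indicator (coset x J) ∈ N := by
  induction J using Finset.induction_on generalizing x with
  | empty => exact hN _ ⟨x, ∅, (Nat.le_zero.1 hJ).symm, rfl⟩
  | insert i J hi ih =>
    rcases hJ.eq_or_lt with h | h
    · exact hN _ ⟨x, _, h.symm, rfl⟩
    · rw [Finset.card_insert_of_notMem hi, Nat.lt_succ_iff] at h
      rw [indicator_coset_insert hi]
      exact N.add_mem (ih h x) (ih h _)

/-! ### Algebraic normal form and Reed-Muller codes -/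

/-- The set of positions at which the bit string `x` is one. -/
def ones (x : Cube m) : Finset (Fin m) := Finset.univ.filter fun i => x i = 1

theorem mem_ones {x : Cube m} {i : Fin m} : i ∈ ones x ↔ x i = 1 := by simp [ones]

theorem ones_incidence (J : Finset (Fin m)) : ones (incidence J) = J := by
  ext i
  simp [mem_ones, incidence]

theorem incidence_ones (x : Cube m) : incidence (ones x) = x := by
  funext i
  simp only [incidence, mem_ones]
  generalize x i = a
  revert a
  decide

theorem ones_subset_iff {x : Cube m} {K : Finset (Fin m)} : ones x ⊆ K ↔ x ∈ stdCube K := by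
  rw [mem_stdCube]
  refine forall_congr' fun i => ?_
  rw [mem_ones]
  generalize x i = a
  by_cases hi : i ∈ K
  · simp [hi]
  · simp only [hi, imp_false, not_false_eq_true, forall_const]
    revert a
    decide

theorem sum_stdCube {M : Type*} [AddCommMonoid M] (K : Finset (Fin m)) (g : Cube m → M) :
    ∑ x ∈ stdCube K, g x = ∑ T ∈ K.powerset, g (incidence T) := by
  refine Finset.sum_bij' (fun x _ => ones x) (fun T _ => incidence T) ?_ ?_ ?_ ?_ ?_
  · intro x hx
    exact Finset.mem_powerset.2 (ones_subset_iff.2 hx)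
  · intro T hT
    rw [← ones_subset_iff, ones_incidence]
    exact Finset.mem_powerset.1 hT
  · exact fun x _ => incidence_ones x
  · exact fun T _ => ones_incidence T
  · intro x _
    rw [incidence_ones]

/-- The monomial function `∏ i ∈ J, x i`. -/
def mono (J : Finset (Fin m)) : Cube m → Fin 2 := fun x => if J ⊆ ones x then 1 else 0

theorem mono_eq_indicator (J : Finset (Fin m)) :
    mono J = indicator (coset (incidence J) Jᶜ) := by
  funext x
  simp only [mono, indicator]
  congr 1
  rw [mem_coset, eq_iff_iff]
  refine forall_congr' fun i => ?_
  by_cases hi : i ∈ J <;> simp [hi, incidence, mem_ones]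

theorem mono_flip {i : Fin m} {L : Finset (Fin m)} (hi : i ∉ L) (x : Cube m) :
    mono L (flip i x) = mono L x := by
  simp only [mono]
  congr 1
  rw [eq_iff_iff]
  refine forall_congr' fun j => forall_congr' fun hj => ?_
  rw [mem_ones, mem_ones, flip_of_ne (by rintro rfl; exact hi hj)]

/-- The coefficient of the monomial `mono J` in the algebraic normal form of `f`. -/
def coeff (f : Cube m → Fin 2) (J : Finset (Fin m)) : Fin 2 := ∑ x ∈ stdCube J, f x

theorem coeff_add (f g : Cube m → Fin 2) (J : Finset (Fin m)) :
    coeff (f + g) J = coeff f J + coeff g J := Finset.sum_add_distrib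

theorem coeff_smul (a : Fin 2) (f : Cube m → Fin 2) (J : Finset (Fin m)) :
    coeff (a • f) J = a * coeff f J := (Finset.mul_sum _ _ _).symm

theorem coeff_sum {α : Type*} (s : Finset α) (F : α → Cube m → Fin 2) (J : Finset (Fin m)) :
    coeff (∑ a ∈ s, F a) J = ∑ a ∈ s, coeff (F a) J := by
  simp only [coeff, Finset.sum_apply]
  exact Finset.sum_comm

/-- If `J` has a direction outside `L`, flipping it cancels the sum in pairs; if `J ⊆ L`, only the
vertex `e_L` can contribute, and it lies in `⟨J⟩` only for `L = J`. -/
theorem coeff_mono (L J : Finset (Fin m)) : coeff (mono L) J = if L = J then 1 else 0 := by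
  by_cases h : J ⊆ L
  · rw [coeff, sum_stdCube]
    simp only [mono, ones_incidence]
    by_cases hLJ : L = J
    · subst hLJ
      rw [Finset.sum_eq_single_of_mem L (Finset.mem_powerset_self L)]
      · simp
      · intro T hT hne
        exact if_neg fun hLT => hne ((Finset.mem_powerset.1 hT).antisymm hLT)
    · rw [if_neg hLJ]
      refine Finset.sum_eq_zero fun T hT => if_neg fun hLT => hLJ ?_
      exact (hLT.trans (Finset.mem_powerset.1 hT)).antisymm h
  · obtain ⟨i, hiJ, hiL⟩ := Finset.not_subset.1 h
    rw [if_neg (by rintro rfl; exact h subset_rfl), coeff, ← coset_zero]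
    exact sum_coset_eq_zero_of_flip hiJ 0 (mono_flip hiL)

theorem sum_coeff_smul_mono (f : Cube m → Fin 2) : ∑ J, coeff f J • mono J = f := by
  funext x
  have h1 : (∑ J, coeff f J • mono J) x = ∑ J ∈ (ones x).powerset, coeff f J := by
    rw [Finset.sum_apply, ← Finset.sum_filter_add_sum_filter_not _ (· ⊆ ones x)]
    rw [Finset.sum_eq_zero (s := Finset.univ.filter fun J => ¬ J ⊆ ones x), add_zero]
    · refine Finset.sum_congr (by ext; simp) fun J hJ => ?_
      simp [mono, Finset.mem_powerset.1 hJ]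
    · intro J hJ
      simp [mono, (Finset.mem_filter.1 hJ).2]
  rw [h1]
  simp only [coeff, sum_stdCube]
  -- Möbius inversion: after the exchange the value at `e_T` is counted once for each set between
  -- `T` and `ones x`, an even number of times unless `T = ones x`.
  rw [Finset.sum_comm' (t' := (ones x).powerset) (s' := fun T => Finset.Icc T (ones x))]
  · rw [Finset.sum_eq_single_of_mem (ones x) (Finset.mem_powerset_self _)]
    · simp [incidence_ones]
    · intro T hT hne
      have hT := Finset.mem_powerset.1 hT
      rw [Finset.sum_const, Finset.card_Icc_finset hT]
      have : (ones x).card - T.card ≠ 0 := by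
        have := Finset.card_lt_card (hT.ssubset_of_ne hne)
        omega
      rw [nsmul_eq_mul, Nat.cast_pow, show ((2 : ℕ) : Fin 2) = 0 from rfl, zero_pow this, zero_mul]
  · intro J T
    simp only [Finset.mem_powerset, Finset.mem_Icc]
    exact ⟨fun h => ⟨⟨h.2, h.1⟩, h.2.trans h.1⟩, fun h => ⟨h.1.2, h.1.1⟩⟩

/-- The binary Reed-Muller code of functions of degree at most `d`. -/
def reedMuller (m d : ℕ) : AddSubgroup (Cube m → Fin 2) where
  carrier := {f | ∀ J : Finset (Fin m), d < J.card → coeff f J = 0}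
  zero_mem' := fun J _ => by simp [coeff]
  add_mem' := fun hf hg J hJ => by rw [coeff_add, hf J hJ, hg J hJ, add_zero]
  neg_mem' := fun {f} hf J hJ => by
    have : coeff (-f) J = - coeff f J := Finset.sum_neg_distrib _
    rw [this, hf J hJ, neg_zero]

theorem reedMuller_mono {d e : ℕ} (h : d ≤ e) : reedMuller m d ≤ reedMuller m e :=
  fun _ hf J hJ => hf J (h.trans_lt hJ)

theorem mono_mem_reedMuller {d : ℕ} {L : Finset (Fin m)} (hL : L.card ≤ d) :
    mono L ∈ reedMuller m d := fun J hJ => by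
  rw [coeff_mono, if_neg (by rintro rfl; omega)]

theorem smul_mem_addSubgroup (N : AddSubgroup (Cube m → Fin 2)) (a : Fin 2)
    {f : Cube m → Fin 2} (hf : f ∈ N) : a • f ∈ N := by
  have : a = 0 ∨ a = 1 := by revert a; decide
  rcases this with rfl | rfl
  · rw [zero_smul]; exact N.zero_mem
  · rwa [one_smul]

theorem reedMuller_le {d : ℕ} {N : AddSubgroup (Cube m → Fin 2)}
    (hN : ∀ L : Finset (Fin m), L.card ≤ d → mono L ∈ N) : reedMuller m d ≤ N := by
  intro f hf
  rw [← sum_coeff_smul_mono f]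
  refine N.sum_mem fun J _ => ?_
  by_cases hJ : J.card ≤ d
  · exact smul_mem_addSubgroup N _ (hN J hJ)
  · rw [hf J (not_le.1 hJ), zero_smul]
    exact N.zero_mem

/-- A set of more than `q` directions meets every set of `m - q` directions, and flipping along a
common one cancels the coefficient. -/
theorem indicator_mem_reedMuller {q : ℕ} {A : Finset (Cube m)} (hA : IsSubcube (m - q) A) :
    indicator A ∈ reedMuller m q := by
  obtain ⟨x, J, hJ, rfl⟩ := hA
  intro L hL
  obtain ⟨i, hi⟩ : (L ∩ J).Nonempty := by
    rw [← Finset.card_pos]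
    have h1 := Finset.card_union_add_card_inter L J
    have h2 := Finset.card_le_univ (L ∪ J)
    rw [Fintype.card_fin] at h2
    omega
  rw [Finset.mem_inter] at hi
  rw [coeff, ← coset_zero]
  refine sum_coset_eq_zero_of_flip hi.1 0 fun y => ?_
  simp only [indicator]
  congr 1
  rw [eq_iff_iff]
  refine ⟨fun h => ?_, flip_mem_coset hi.2⟩
  rw [← flip_flip i y]
  exact flip_mem_coset hi.2 h

/-- The indicators of the `(m - q)`-cubes generate the Reed-Muller code of degree `q`. -/
theorem reedMuller_le_of_subcube {q : ℕ} {N : AddSubgroup (Cube m → Fin 2)}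
    (hN : ∀ A : Finset (Cube m), IsSubcube (m - q) A → indicator A ∈ N) :
    reedMuller m q ≤ N := by
  refine reedMuller_le fun L hL => ?_
  rw [mono_eq_indicator]
  refine indicator_mem_of_subcube N hN _ ?_ _
  rw [Finset.card_compl, Fintype.card_fin]
  omega

/-- The sum over a set of vertices, as an additive functional. -/
def pairing (g : Cube m → Fin 2) : (Cube m → Fin 2) →+ Fin 2 where
  toFun h := ∑ x, h x * g x
  map_zero' := by simp
  map_add' := fun a b => by simp [add_mul, Finset.sum_add_distrib]

theorem pairing_indicator (g : Cube m → Fin 2) (A : Finset (Cube m)) :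
    pairing g (indicator A) = ∑ x ∈ A, g x := by
  simp [pairing, indicator]

/-- The Reed-Muller code of degree `r` is dual to the span of the `(r + 1)`-cubes. -/
theorem mem_reedMuller_iff_sum_subcube {r : ℕ} {f : Cube m → Fin 2} :
    f ∈ reedMuller m r ↔ ∀ A : Finset (Cube m), IsSubcube (r + 1) A → ∑ x ∈ A, f x = 0 := by
  constructor
  · rintro hf _ ⟨x, J, hJ, rfl⟩
    -- Orthogonality to a fixed cube is a subgroup condition, so it need only be checked on
    -- monomials of degree at most `r`; each misses one of the `r + 1` directions of the cube.
    let N : AddSubgroup (Cube m → Fin 2) := (pairing (indicator (coset x J))).ker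
    have hN : ∀ g, g ∈ N ↔ ∑ y ∈ coset x J, g y = 0 := by
      intro g
      rw [AddMonoidHom.mem_ker, ← pairing_indicator]
      simp [pairing, mul_comm]
    refine (hN f).1 (reedMuller_le (fun L hL => (hN _).2 ?_) hf)
    obtain ⟨i, hiJ, hiL⟩ := Finset.exists_mem_notMem_of_card_lt_card (s := L) (t := J) (by omega)
    exact sum_coset_eq_zero_of_flip hiJ x (mono_flip hiL)
  · intro h J hJ
    rw [coeff, ← coset_zero, ← pairing_indicator]
    exact indicator_mem_of_subcube (pairing f).ker
      (fun A hA => by rw [AddMonoidHom.mem_ker, pairing_indicator, h A hA]) J hJ 0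

/-! ### Pauli operators and diagonal operators -/

theorem add_self {ι : Type} (f : ι → Fin 2) : f + f = 0 :=
  funext fun _ => CharTwo.add_self_eq_zero _

section Operators

variable {ι : Type} [Fintype ι] [DecidableEq ι]

theorem onSet_pauliX_apply (A : Finset ι) (f g : ι → Fin 2) :
    onSet pauliX A f g = if g = f + indicator A then 1 else 0 := by
  have h : ∀ x, (if x ∈ A then pauliX else 1) (f x) (g x) =
      if g x = f x + indicator A x then (1 : ℂ) else 0 := by
    intro x
    by_cases hx : x ∈ A
    · simp only [hx, indicator, if_true]
      generalize f x = a
      generalize g x = b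
      fin_cases a <;> fin_cases b <;> simp [pauliX]
    · simp only [hx, indicator, if_false, add_zero]
      rw [Matrix.one_apply]
      simp only [eq_comm]
  refine (Finset.prod_congr rfl fun x _ => h x).trans ?_
  rw [Finset.prod_ite_zero]
  simp [funext_iff]

theorem onSet_pauliX_mulVec (A : Finset ι) (ψ : (ι → Fin 2) → ℂ) (f : ι → Fin 2) :
    (onSet pauliX A *ᵥ ψ) f = ψ (f + indicator A) := by
  refine (Finset.sum_eq_single (f + indicator A) ?_ ?_).trans ?_
  · intro g _ hg
    beta_reduce
    rw [onSet_pauliX_apply, if_neg hg, zero_mul]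
  · exact fun h => absurd (Finset.mem_univ _) h
  · beta_reduce
    rw [onSet_pauliX_apply, if_pos rfl, one_mul]

theorem tensorOp_diagonal {ι : Type} [Fintype ι] (d : ι → Fin 2 → ℂ) :
    tensorOp (fun x => Matrix.diagonal (d x)) = Matrix.diagonal fun f => ∏ x, d x (f x) := by
  ext f g
  simp only [tensorOp, Matrix.of_apply, Matrix.diagonal_apply]
  rw [Finset.prod_ite_zero]
  simp [funext_iff]

/-- The nontrivial character of `ZMod 2`. -/
def sign (a : Fin 2) : ℂ := if a = 0 then 1 else -1

theorem sign_add (a b : Fin 2) : sign (a + b) = sign a * sign b := by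
  have : ∀ a : Fin 2, a = 0 ∨ a = 1 := by decide
  rcases this a with rfl | rfl <;> rcases this b with rfl | rfl <;>
    simp [sign, CharTwo.add_self_eq_zero]

theorem sign_sum {α : Type*} (s : Finset α) (g : α → Fin 2) :
    sign (∑ a ∈ s, g a) = ∏ a ∈ s, sign (g a) := by
  classical
  induction s using Finset.induction_on with
  | empty => simp [sign]
  | insert a s ha ih => rw [Finset.sum_insert ha, Finset.prod_insert ha, sign_add, ih]

theorem onSet_pauliZ (A : Finset ι) :
    onSet pauliZ A = Matrix.diagonal fun f : ι → Fin 2 => sign (∑ x ∈ A, f x) := by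
  have h : (fun x => if x ∈ A then pauliZ else 1) =
      fun x => Matrix.diagonal (if x ∈ A then sign else 1 : Fin 2 → ℂ) := by
    funext x
    by_cases hx : x ∈ A
    · simp only [hx, if_true]
      ext a b
      fin_cases a <;> fin_cases b <;> simp [pauliZ, sign]
    · simp only [hx, if_false]
      exact Matrix.diagonal_one.symm
  rw [onSet, h, tensorOp_diagonal]
  congr 1
  funext f
  rw [sign_sum, ← Finset.prod_subset (Finset.subset_univ A)]
  · exact Finset.prod_congr rfl fun x hx => by simp [hx]
  · intro x _ hx
    simp [hx]

theorem onSet_pauliZ_mulVec (A : Finset ι) (ψ : (ι → Fin 2) → ℂ) (f : ι → Fin 2) :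
    (onSet pauliZ A *ᵥ ψ) f = sign (∑ x ∈ A, f x) * ψ f := by
  rw [onSet_pauliZ]
  exact Matrix.mulVec_diagonal _ _ _

end Operators

/-! ### Code states -/

variable {q r : ℕ}

theorem mem_codeSpace_iff {ψ : (Cube m → Fin 2) → ℂ} :
    ψ ∈ codeSpace m q r ↔
      (∀ g ∈ reedMuller m q, ∀ f, ψ (f + g) = ψ f) ∧ ∀ f, f ∉ reedMuller m r → ψ f = 0 := by
  -- The translations that fix `ψ` form a subgroup, so invariance under the generating cubes extends
  -- to the whole Reed-Muller code.
  let N : AddSubgroup (Cube m → Fin 2) :=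
    { carrier := {g | ∀ f, ψ (f + g) = ψ f}
      zero_mem' := fun f => by rw [add_zero]
      add_mem' := fun {a b} ha hb f => by rw [← add_assoc, hb, ha]
      neg_mem' := fun {a} ha f => by rw [← ha (f + -a), neg_add_cancel_right] }
  constructor
  · rintro ⟨hX, hZ⟩
    refine ⟨reedMuller_le_of_subcube (N := N) fun A hA f => ?_, fun f hf => ?_⟩
    · exact (onSet_pauliX_mulVec A ψ f).symm.trans (congrFun (hX A hA) f)
    · rw [mem_reedMuller_iff_sum_subcube] at hf
      push Not at hf
      obtain ⟨A, hA, hne⟩ := hf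
      have h := onSet_pauliZ_mulVec A ψ f
      rw [hZ A hA, sign, if_neg hne] at h
      linear_combination h / 2
  · rintro ⟨hX, hZ⟩
    refine ⟨fun A hA => funext fun f => ?_, fun A hA => funext fun f => ?_⟩
    · exact (onSet_pauliX_mulVec A ψ f).trans (hX _ (indicator_mem_reedMuller hA) f)
    · refine (onSet_pauliZ_mulVec A ψ f).trans ?_
      by_cases hf : f ∈ reedMuller m r
      · rw [mem_reedMuller_iff_sum_subcube.1 hf A hA, sign, if_pos rfl, one_mul]
      · exact (congrArg _ (hZ f hf)).trans ((mul_zero _).trans (hZ f hf).symm)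

/-- Diagonal operators which agree on the Reed-Muller code of degree `r` are logically
equivalent. -/
theorem logicallyEquivalent_diagonal {u v : (Cube m → Fin 2) → ℂ}
    (h : ∀ f ∈ reedMuller m r, u f = v f) :
    LogicallyEquivalent m q r (Matrix.diagonal u) (Matrix.diagonal v) := by
  intro ψ hψ
  funext f
  refine (Matrix.mulVec_diagonal u ψ f).trans (Eq.trans ?_ (Matrix.mulVec_diagonal v ψ f).symm)
  by_cases hf : f ∈ reedMuller m r
  · rw [h f hf]
  · have h0 : ψ f = 0 := (mem_codeSpace_iff.1 hψ).2 f hf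
    rw [h0, mul_zero, mul_zero]

/-! ### The encoder -/

/-- The logical bits of a bit string: the coefficients of degree between `q + 1` and `r`. -/
def logicalBits (m q r : ℕ) (f : Cube m → Fin 2) : LogicalQubit m q r → Fin 2 :=
  fun J => coeff f J.1

theorem logicalBits_add (f g : Cube m → Fin 2) :
    logicalBits m q r (f + g) = logicalBits m q r f + logicalBits m q r g :=
  funext fun J => coeff_add f g J.1

theorem logicalBits_mono (J : LogicalQubit m q r) :
    logicalBits m q r (mono J.1) = indicator {J} := by
  funext L
  simp [logicalBits, coeff_mono, indicator, Subtype.ext_iff, eq_comm]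

theorem logicalBits_eq_zero {f : Cube m → Fin 2} (hf : f ∈ reedMuller m q) :
    logicalBits m q r f = 0 :=
  funext fun J => hf J.1 J.2.1

/-- With `logicalBits_eq_zero`, this makes the fibres of `logicalBits` on the degree-`r` code the
cosets of the degree-`q` code. -/
theorem mem_reedMuller_of_logicalBits {f : Cube m → Fin 2} (hf : f ∈ reedMuller m r)
    (h : logicalBits m q r f = 0) : f ∈ reedMuller m q := by
  intro J hJ
  by_cases hr : J.card ≤ r
  · exact congrFun h ⟨J, hJ, hr⟩
  · exact hf J (not_le.1 hr)

/-- A representative with given logical bits. -/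
def representative (b : LogicalQubit m q r → Fin 2) : Cube m → Fin 2 := ∑ J, b J • mono J.1

theorem representative_mem (b : LogicalQubit m q r → Fin 2) :
    representative b ∈ reedMuller m r :=
  AddSubgroup.sum_mem _ fun J _ => smul_mem_addSubgroup _ _ (mono_mem_reedMuller J.2.2)

theorem logicalBits_representative (b : LogicalQubit m q r → Fin 2) :
    logicalBits m q r (representative b) = b := by
  funext L
  rw [logicalBits, representative, coeff_sum]
  simp [coeff_smul, coeff_mono, Subtype.val_inj]

open Classical in
/-- The coset of the Reed-Muller code of degree `q` with logical bits `b`. -/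
def codeCoset (m q r : ℕ) (b : LogicalQubit m q r → Fin 2) : Finset (Cube m → Fin 2) :=
  Finset.univ.filter fun f => f ∈ reedMuller m r ∧ logicalBits m q r f = b

theorem mem_codeCoset {b : LogicalQubit m q r → Fin 2} {f : Cube m → Fin 2} :
    f ∈ codeCoset m q r b ↔ f ∈ reedMuller m r ∧ logicalBits m q r f = b := by
  simp [codeCoset]

theorem card_codeCoset (b : LogicalQubit m q r → Fin 2) :
    (codeCoset m q r b).card = (codeCoset m q r 0).card := by
  symm
  refine Finset.card_bij' (fun f _ => f + representative b) (fun f _ => f - representative b)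
    ?_ ?_ ?_ ?_
  · intro f hf
    rw [mem_codeCoset] at hf ⊢
    exact ⟨AddSubgroup.add_mem _ hf.1 (representative_mem b), by
      rw [logicalBits_add, hf.2, logicalBits_representative, zero_add]⟩
  · intro f hf
    rw [mem_codeCoset] at hf ⊢
    refine ⟨AddSubgroup.sub_mem _ hf.1 (representative_mem b), ?_⟩
    have h := logicalBits_add (q := q) (r := r) (f - representative b) (representative b)
    rw [sub_add_cancel, hf.2, logicalBits_representative] at h
    exact left_eq_add.1 (h.trans (add_comm _ _))
  · exact fun f _ => add_sub_cancel_right _ _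
  · exact fun f _ => sub_add_cancel _ _

theorem card_codeCoset_pos : 0 < (codeCoset m q r 0).card :=
  Finset.card_pos.2 ⟨0, mem_codeCoset.2 ⟨AddSubgroup.zero_mem _, logicalBits_eq_zero
    (AddSubgroup.zero_mem _)⟩⟩

/-- The amplitude of the encoded computational basis states. -/
def amplitude (m q r : ℕ) : ℝ := (√((codeCoset m q r 0).card : ℝ))⁻¹

theorem amplitude_ne_zero : (amplitude m q r : ℂ) ≠ 0 := by
  have : (0 : ℝ) < (codeCoset m q r 0).card := by exact_mod_cast card_codeCoset_pos
  exact Complex.ofReal_ne_zero.2 (inv_ne_zero (Real.sqrt_ne_zero'.2 this))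

theorem card_mul_amplitude_sq :
    ((codeCoset m q r 0).card : ℂ) * ((amplitude m q r : ℂ) * amplitude m q r) = 1 := by
  have h : (0 : ℝ) < (codeCoset m q r 0).card := by exact_mod_cast card_codeCoset_pos
  have : ((codeCoset m q r 0).card : ℝ) * (amplitude m q r * amplitude m q r) = 1 := by
    rw [amplitude, ← mul_inv, Real.mul_self_sqrt h.le, mul_inv_cancel₀ h.ne']
  exact_mod_cast this

/-- The encoder: a computational basis state is sent to the uniform superposition over a coset. -/
def encoder (m q r : ℕ) : Matrix (Cube m → Fin 2) (LogicalQubit m q r → Fin 2) ℂ :=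
  Matrix.of fun f b => if f ∈ codeCoset m q r b then (amplitude m q r : ℂ) else 0

theorem encoder_apply (f : Cube m → Fin 2) (b : LogicalQubit m q r → Fin 2) :
    encoder m q r f b = if f ∈ codeCoset m q r b then (amplitude m q r : ℂ) else 0 := rfl

open Classical in
theorem encoder_mulVec (φ : (LogicalQubit m q r → Fin 2) → ℂ) (f : Cube m → Fin 2) :
    (encoder m q r *ᵥ φ) f =
      if f ∈ reedMuller m r then (amplitude m q r : ℂ) * φ (logicalBits m q r f) else 0 := by
  split_ifs with hf
  · refine (Finset.sum_eq_single (logicalBits m q r f) ?_ ?_).trans ?_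
    · intro b _ hb
      beta_reduce
      rw [encoder_apply, if_neg, zero_mul]
      exact fun h => hb (mem_codeCoset.1 h).2.symm
    · exact fun h => absurd (Finset.mem_univ _) h
    · beta_reduce
      rw [encoder_apply, if_pos (mem_codeCoset.2 ⟨hf, rfl⟩)]
  · refine Finset.sum_eq_zero fun b _ => ?_
    beta_reduce
    rw [encoder_apply, if_neg, zero_mul]
    exact fun h => hf (mem_codeCoset.1 h).1

theorem encoder_isometry : (encoder m q r)ᴴ * encoder m q r = 1 := by
  ext b b'
  have h : ∀ f : Cube m → Fin 2, (encoder m q r)ᴴ b f * encoder m q r f b' =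
      if f ∈ codeCoset m q r b ∧ b = b' then (amplitude m q r : ℂ) * amplitude m q r else 0 := by
    intro f
    rw [Matrix.conjTranspose_apply, encoder_apply, encoder_apply]
    by_cases hf : f ∈ codeCoset m q r b
    · rw [if_pos hf]
      by_cases hb : b = b'
      · subst hb
        simp [hf]
      · have hf' : f ∉ codeCoset m q r b' := fun hf' =>
          hb ((mem_codeCoset.1 hf).2.symm.trans (mem_codeCoset.1 hf').2)
        simp [hb, hf']
    · simp [hf]
  rw [Matrix.mul_apply, Finset.sum_congr rfl fun f _ => h f, Matrix.one_apply]
  by_cases hb : b = b'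
  · simp only [hb, and_true, if_true]
    refine Eq.trans ?_ (card_mul_amplitude_sq (m := m) (q := q) (r := r))
    rw [← card_codeCoset b', ← nsmul_eq_mul, ← Finset.sum_const]
    refine (Finset.sum_filter _ _).symm.trans (Finset.sum_congr ?_ fun _ _ => rfl)
    ext f
    simp
  · simp [hb]

theorem encoder_range (hqr : q ≤ r) :
    Set.range (fun φ : (LogicalQubit m q r → Fin 2) → ℂ => encoder m q r *ᵥ φ) =
      codeSpace m q r := by
  classical
  ext ψ
  rw [Set.mem_range]
  constructor
  · rintro ⟨φ, rfl⟩
    refine mem_codeSpace_iff.2 ⟨fun g hg f => ?_, fun f hf => ?_⟩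
    · have hgr : g ∈ reedMuller m r := reedMuller_mono hqr hg
      rw [encoder_mulVec, encoder_mulVec, logicalBits_add, logicalBits_eq_zero hg, add_zero]
      simp only [AddSubgroup.add_mem_cancel_right _ hgr]
    · rw [encoder_mulVec, if_neg hf]
  · intro hψ
    obtain ⟨h1, h2⟩ := mem_codeSpace_iff.1 hψ
    -- A code state is constant on each coset, so its value at one representative determines the
    -- preimage.
    refine ⟨fun b => (amplitude m q r : ℂ)⁻¹ * ψ (representative b), funext fun f => ?_⟩
    refine (encoder_mulVec _ f).trans ?_
    split_ifs with hf
    · rw [mul_inv_cancel_left₀ amplitude_ne_zero]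
      set b := logicalBits m q r f
      have hd : f - representative b ∈ reedMuller m q := by
        refine mem_reedMuller_of_logicalBits
          (AddSubgroup.sub_mem _ hf (representative_mem b)) ?_
        have h := logicalBits_add (q := q) (r := r) (f - representative b) (representative b)
        rw [sub_add_cancel, logicalBits_representative] at h
        exact left_eq_add.1 (h.trans (add_comm _ _))
      rw [← h1 _ hd, add_sub_cancel]
    · exact (h2 f hf).symm

theorem logicalX_mul_encoder (J : LogicalQubit m q r) :
    logicalX J * encoder m q r = encoder m q r * onSet pauliX {J} := by
  ext f b
  have hJ : mono J.1 ∈ reedMuller m r := mono_mem_reedMuller J.2.2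
  have hl : (logicalX J * encoder m q r) f b = encoder m q r (f + mono J.1) b := by
    rw [mono_eq_indicator]
    exact onSet_pauliX_mulVec _ (fun g => encoder m q r g b) f
  have hr : (encoder m q r * onSet pauliX {J}) f b = encoder m q r f (b + indicator {J}) := by
    refine (Finset.sum_eq_single (b + indicator {J}) ?_ ?_).trans ?_
    · intro g _ hg
      beta_reduce
      rw [onSet_pauliX_apply, if_neg, mul_zero]
      rintro rfl
      exact hg (by rw [add_assoc, add_self, add_zero])
    · exact fun h => absurd (Finset.mem_univ _) h
    · beta_reduce
      rw [onSet_pauliX_apply, if_pos, mul_one]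
      rw [add_assoc, add_self, add_zero]
  rw [hl, hr, encoder_apply, encoder_apply]
  congr 1
  rw [mem_codeCoset, mem_codeCoset, AddSubgroup.add_mem_cancel_right _ hJ, logicalBits_add,
    logicalBits_mono, eq_iff_iff]
  refine and_congr_right fun _ => ⟨?_, ?_⟩
  · rintro rfl
    rw [add_assoc, add_self, add_zero]
  · intro h
    rw [h, add_assoc, add_self, add_zero]

/-- Serves both the logical `Z` operators and the final circuit: a phase that depends only on the
logical bits passes through the encoder. -/
theorem diagonal_mul_encoder {u : (Cube m → Fin 2) → ℂ} {v : (LogicalQubit m q r → Fin 2) → ℂ}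
    (h : ∀ f ∈ reedMuller m r, u f = v (logicalBits m q r f)) :
    (Matrix.diagonal u : Op (Cube m)) * encoder m q r =
      encoder m q r * (Matrix.diagonal v : Op (LogicalQubit m q r)) := by
  ext f b
  refine (Matrix.diagonal_mul u (encoder m q r) f b).trans
    (Eq.trans ?_ (Matrix.mul_diagonal v (encoder m q r) f b).symm)
  rw [encoder_apply]
  split_ifs with hf
  · obtain ⟨hf', rfl⟩ := mem_codeCoset.1 hf
    rw [h f hf', mul_comm]
  · rw [mul_zero, zero_mul]

theorem isEncoder_encoder (hqr : q ≤ r) : IsEncoder m q r (encoder m q r) where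
  isometry := encoder_isometry
  range_eq := encoder_range hqr
  map_X := logicalX_mul_encoder
  map_Z J := by
    rw [logicalZ, onSet_pauliZ, onSet_pauliZ]
    exact diagonal_mul_encoder fun f _ => by rw [Finset.sum_singleton]; rfl

variable {k : ℕ}

/-! ### Weighted counts modulo powers of two -/

/-- The monomials which occur in the algebraic normal form of `f`. -/
def monomials (f : Cube m → Fin 2) : Finset (Finset (Fin m)) :=
  Finset.univ.filter fun J => coeff f J = 1

theorem mem_monomials {f : Cube m → Fin 2} {J : Finset (Fin m)} :
    J ∈ monomials f ↔ coeff f J = 1 := by simp [monomials]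

/-- The integer-valued version of the nontrivial character of `ZMod 2`. -/
def intSign (a : Fin 2) : ℤ := 1 - 2 * (a.val : ℤ)

theorem intSign_sum {α : Type*} (s : Finset α) (g : α → Fin 2) :
    intSign (∑ a ∈ s, g a) = ∏ a ∈ s, intSign (g a) := by
  classical
  have hadd : ∀ a b : Fin 2, intSign (a + b) = intSign a * intSign b := by decide
  induction s using Finset.induction_on with
  | empty => rfl
  | insert a s ha ih => rw [Finset.sum_insert ha, Finset.prod_insert ha, hadd, ih]

theorem eq_sum_monomials (f : Cube m → Fin 2) : f = ∑ J ∈ monomials f, mono J := by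
  conv_lhs => rw [← sum_coeff_smul_mono f]
  rw [monomials, Finset.sum_filter]
  refine Finset.sum_congr rfl fun J _ => ?_
  have : coeff f J = 0 ∨ coeff f J = 1 := by generalize coeff f J = a; revert a; decide
  rcases this with h | h <;> simp [h]

theorem intSign_eq_sum (f : Cube m → Fin 2) (x : Cube m) :
    intSign (f x) = ∑ 𝒥 ∈ (monomials f).powerset,
      if 𝒥.sup id ⊆ ones x then (-2 : ℤ) ^ 𝒥.card else 0 := by
  have h : ∀ J, intSign (mono J x) = (if J ⊆ ones x then (-2 : ℤ) else 0) + 1 := by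
    intro J
    by_cases hJ : J ⊆ ones x <;> simp [mono, hJ, intSign]
  conv_lhs => rw [eq_sum_monomials f, Finset.sum_apply, intSign_sum]
  simp only [h]
  rw [Finset.prod_add_one]
  refine Finset.sum_congr rfl fun 𝒥 _ => ?_
  rw [Finset.prod_ite_zero, Finset.prod_const]
  congr 1
  rw [eq_iff_iff]
  exact (Finset.sup_le_iff (f := id)).symm

/-- The weights on `⟨K⟩` for which the weighted count of a function of low degree depends only on
the minimal covers of `K`. -/
structure IsCubeWeight (K : Finset (Fin m)) (w : Cube m → ℤ) : Prop where
  odd_top : Odd (w (incidence K))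
  dvd : ∀ L ⊆ K, (2 : ℤ) ^ (K.card - L.card) ∣ ∑ T ∈ Finset.Icc L K, w (incidence T)

theorem isCubeWeight_one (K : Finset (Fin m)) : IsCubeWeight K fun _ => 1 where
  odd_top := odd_one
  dvd L hL := by
    rw [Finset.sum_const, Finset.card_Icc_finset hL]
    simp

/-- The alternating sum over the interval from `L` to `K` vanishes unless `L = K`, where the
required divisor is `2 ^ 0`. -/
theorem isCubeWeight_neg_one_pow (K : Finset (Fin m)) :
    IsCubeWeight K fun x => (-1) ^ hammingNorm x where
  odd_top := Odd.pow (by decide)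
  dvd L hL := by
    have hn : ∀ T : Finset (Fin m), hammingNorm (incidence T) = T.card := by
      intro T
      simp [hammingNorm, incidence]
    simp only [hn]
    rw [Finset.Icc_eq_image_powerset hL, Finset.sum_image]
    · have h : ∀ T ∈ (K \ L).powerset, (-1 : ℤ) ^ (L ∪ T).card = (-1) ^ L.card * (-1) ^ T.card := by
        intro T hT
        rw [← pow_add, Finset.card_union_of_disjoint]
        exact Finset.disjoint_of_subset_right (Finset.mem_powerset.1 hT) Finset.disjoint_sdiff
      rw [Finset.sum_congr rfl h, ← Finset.mul_sum, Finset.sum_powerset_neg_one_pow_card]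
      split_ifs with h0
      · have := Finset.card_le_card (Finset.sdiff_eq_empty_iff_subset.1 h0)
        rw [Nat.sub_eq_zero_of_le this]
        simp
      · simp
    · intro A hA B hB hAB
      have hd : ∀ T ∈ (K \ L).powerset, (L ∪ T) \ L = T := fun T hT => by
        rw [Finset.union_sdiff_left]
        exact Finset.sdiff_eq_self_of_disjoint (Finset.disjoint_of_subset_left
          (Finset.mem_powerset.1 hT) Finset.sdiff_disjoint)
      rw [← hd A hA, ← hd B hB]
      exact congrArg (· \ L) hAB

/-- The families of `k + 1` monomials of `f` with union `K`. -/
def monomialCovers (k : ℕ) (K : Finset (Fin m)) (f : Cube m → Fin 2) :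
    Finset (Finset (Finset (Fin m))) :=
  (monomials f).powerset.filter fun 𝒥 => 𝒥.card = k + 1 ∧ 𝒥.sup id = K

theorem card_sup_le {f : Cube m → Fin 2} (hf : f ∈ reedMuller m r)
    {𝒥 : Finset (Finset (Fin m))} (h𝒥 : 𝒥 ⊆ monomials f) : (𝒥.sup id).card ≤ 𝒥.card * r := by
  rw [Finset.sup_eq_biUnion]
  refine Finset.card_biUnion_le_card_mul _ _ _ fun J hJ => ?_
  by_contra hlt
  have h1 := mem_monomials.1 (h𝒥 hJ)
  rw [hf J (not_le.1 hlt)] at h1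
  exact absurd h1 (by decide)

theorem weighted_sum_intSign (K : Finset (Fin m)) (w : Cube m → ℤ) (f : Cube m → Fin 2) :
    ∑ x ∈ stdCube K, w x * intSign (f x) = ∑ 𝒥 ∈ (monomials f).powerset,
      (-2 : ℤ) ^ 𝒥.card * ∑ T ∈ Finset.Icc (𝒥.sup id) K, w (incidence T) := by
  rw [sum_stdCube]
  simp only [intSign_eq_sum, ones_incidence, Finset.mul_sum]
  rw [Finset.sum_comm]
  refine Finset.sum_congr rfl fun 𝒥 _ => ?_
  have h : Finset.Icc (𝒥.sup id) K = K.powerset.filter fun T => 𝒥.sup id ⊆ T := by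
    ext T
    simp only [Finset.mem_Icc, Finset.mem_filter, Finset.mem_powerset]
    exact and_comm
  rw [h, Finset.sum_filter]
  refine Finset.sum_congr rfl fun T _ => ?_
  split_ifs
  · exact mul_comm _ _
  · exact mul_zero _

theorem weighted_sum_intSign_modEq {K : Finset (Fin m)} {w : Cube m → ℤ} (hw : IsCubeWeight K w)
    {f : Cube m → Fin 2} (hf : f ∈ reedMuller m r) (hr : 1 ≤ r) (hK : k * r + 2 ≤ K.card) :
    ∑ x ∈ stdCube K, w x * intSign (f x) ≡ 2 ^ (k + 1) * (monomialCovers k K f).card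
      [ZMOD 2 ^ (k + 2)] := by
  rw [weighted_sum_intSign, monomialCovers, Finset.card_filter, Nat.cast_sum, Finset.mul_sum]
  refine Int.ModEq.sum fun 𝒥 h𝒥 => ?_
  have hc := card_sup_le hf (Finset.mem_powerset.1 h𝒥)
  set L := 𝒥.sup id
  set j := 𝒥.card
  have hzero : ∀ z : ℤ, (2 : ℤ) ^ (k + 2) ∣ z → z ≡ 0 [ZMOD 2 ^ (k + 2)] := fun z hz =>
    Int.modEq_zero_iff_dvd.2 hz
  have hneg : ∀ n : ℕ, (2 : ℤ) ^ n ∣ (-2) ^ n := fun n => pow_dvd_pow_of_dvd (by norm_num) n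
  by_cases hLK : L ⊆ K
  · rcases hLK.eq_or_ssubset with heq | hss
    · have hj : k < j := by
        rw [heq] at hc
        by_contra hle
        have := Nat.mul_le_mul_right r (not_lt.1 hle)
        omega
      rcases (Nat.succ_le_of_lt hj).eq_or_lt with hj' | hj'
      · obtain ⟨t, ht⟩ := hw.odd_top
        obtain ⟨s, hs⟩ : Odd ((-1 : ℤ) ^ (k + 1) * w (incidence K)) :=
          (Odd.pow (by decide)).mul ⟨t, ht⟩
        rw [heq, Finset.Icc_self, Finset.sum_singleton, if_pos ⟨hj'.symm, rfl⟩, ← hj',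
          show (-2 : ℤ) = -1 * 2 by norm_num, mul_pow, mul_right_comm]
        change (-1) ^ (k + 1) * w (incidence K) * 2 ^ (k + 1) ≡ _ [ZMOD _]
        rw [hs]
        refine (Int.modEq_iff_dvd.2 ⟨-s, ?_⟩)
        push_cast
        ring
      · rw [if_neg (by omega)]
        refine (hzero _ ?_).trans (by simp)
        exact ((pow_dvd_pow 2 (show k + 2 ≤ j by omega)).trans (hneg j)).mul_right _
    · rw [if_neg (fun h => hss.ne h.2)]
      refine (hzero _ ?_).trans (by simp)
      refine dvd_trans ?_ (mul_dvd_mul (hneg j) (hw.dvd L hLK))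
      rw [← pow_add]
      refine pow_dvd_pow 2 ?_
      have hlt := Finset.card_lt_card hss
      -- The goal is `k + 2 ≤ j + (|K| - |L|)`. For `j > k` the strict inclusion supplies the
      -- missing unit; for `k = j + d` the gap `|K| - |L|` is at least `d * r + 2 ≥ d + 2`.
      rcases Nat.lt_or_ge k j with h | h
      · omega
      · obtain ⟨d, rfl⟩ := Nat.exists_eq_add_of_le h
        have : d ≤ d * r := Nat.le_mul_of_pos_right d hr
        rw [add_mul] at hK
        omega
  · rw [if_neg (fun h => hLK h.2.subset), Finset.Icc_eq_empty hLK]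
    simp

/-- A weighted count of a function of degree at most `r` is, modulo `2 ^ (k + 1)`, equal to `2 ^ k`
times the number of its covers of `K`. -/
theorem weighted_sum_modEq {K : Finset (Fin m)} {w : Cube m → ℤ} (hw : IsCubeWeight K w)
    {f : Cube m → Fin 2} (hf : f ∈ reedMuller m r) (hr : 1 ≤ r) (hK : k * r + 2 ≤ K.card) :
    ∑ x ∈ stdCube K, w x * ((f x).val : ℤ) ≡ 2 ^ k * (monomialCovers k K f).card
      [ZMOD 2 ^ (k + 1)] := by
  have h1 := weighted_sum_intSign_modEq hw hf hr hK
  have h0 : (2 : ℤ) ^ (k + 2) ∣ ∑ x ∈ stdCube K, w x := by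
    have h := hw.dvd ∅ (Finset.empty_subset K)
    rw [show Finset.Icc ∅ K = K.powerset by ext; simp, ← sum_stdCube] at h
    refine dvd_trans (pow_dvd_pow 2 ?_) h
    have := Nat.le_mul_of_pos_right k hr
    rw [Finset.card_empty]
    omega
  -- Passing from signs `1 - 2 * f` back to `f` costs one factor of two in the modulus; the constant
  -- term vanishes by `h0`.
  have h2 : ∑ x ∈ stdCube K, w x * intSign (f x) =
      ∑ x ∈ stdCube K, w x - 2 * ∑ x ∈ stdCube K, w x * ((f x).val : ℤ) := by
    rw [Finset.mul_sum, ← Finset.sum_sub_distrib]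
    refine Finset.sum_congr rfl fun x _ => ?_
    rw [intSign]
    ring
  rw [h2] at h1
  obtain ⟨a, ha⟩ := h0
  obtain ⟨b, hb⟩ := Int.modEq_iff_dvd.1 h1
  refine Int.modEq_iff_dvd.2 ⟨(monomialCovers k K f).card - b - a, ?_⟩
  rw [ha] at hb
  simp only [pow_succ] at hb ⊢
  linarith

/-! ### Phases of transversal rotations -/

/-- The phase of the rotation `rotZ k`. -/
def phase (k : ℕ) : ℂ := Complex.exp (Complex.I * (Real.pi : ℂ) / 2 ^ k)

theorem phase_ne_zero : phase k ≠ 0 := Complex.exp_ne_zero _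

theorem phase_pow : phase k ^ 2 ^ k = -1 := by
  rw [phase, ← Complex.exp_nat_mul, ← Complex.exp_pi_mul_I]
  congr 1
  push_cast
  field_simp

theorem phase_zpow_of_modEq {n : ℤ} {c : ℕ} (h : n ≡ 2 ^ k * c [ZMOD 2 ^ (k + 1)]) :
    phase k ^ n = (-1) ^ c := by
  obtain ⟨t, ht⟩ := Int.modEq_iff_dvd.1 h
  have hn : n = ((2 ^ k : ℕ) : ℤ) * (c + 2 * -t) := by
    push_cast
    rw [pow_succ] at ht
    linarith
  rw [hn, zpow_mul, zpow_natCast, phase_pow, zpow_add₀ (by norm_num), zpow_mul, zpow_natCast]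
  norm_num

theorem star_phase : star (phase k) = (phase k)⁻¹ := by
  rw [phase, ← Complex.exp_neg]
  change (starRingEnd ℂ) _ = _
  rw [← Complex.exp_conj]
  congr 1
  rw [map_div₀, map_mul, map_pow, Complex.conj_I, Complex.conj_ofReal, map_ofNat]
  ring

/-- The diagonal entries of an integer power of `rotZ k`. -/
def phaseDiagonal (k : ℕ) (n : ℤ) : Fin 2 → ℂ := fun a => phase k ^ (n * (a.val : ℤ))

theorem rotZ_eq : rotZ k = Matrix.diagonal (phaseDiagonal k 1) := by
  ext a b
  fin_cases a <;> fin_cases b <;> simp [rotZ, phaseDiagonal, phase]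

theorem rotZ_conjTranspose : (rotZ k)ᴴ = Matrix.diagonal (phaseDiagonal k (-1)) := by
  rw [rotZ_eq, Matrix.diagonal_conjTranspose]
  congr 1
  funext a
  fin_cases a <;> simp [phaseDiagonal, ← star_phase]

theorem tensorOp_phaseDiagonal (A : Finset (Cube m)) (w : Cube m → ℤ) :
    tensorOp (fun x => if x ∈ A then Matrix.diagonal (phaseDiagonal k (w x)) else 1) =
      Matrix.diagonal fun f => phase k ^ ∑ x ∈ A, w x * ((f x).val : ℤ) := by
  have h : (fun x => if x ∈ A then Matrix.diagonal (phaseDiagonal k (w x)) else 1) =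
      fun x => Matrix.diagonal (if x ∈ A then phaseDiagonal k (w x) else 1) := by
    funext x
    split_ifs
    · rfl
    · exact Matrix.diagonal_one.symm
  rw [h, tensorOp_diagonal]
  congr 1
  funext f
  have hz : ∀ s : Finset (Cube m), phase k ^ ∑ x ∈ s, w x * ((f x).val : ℤ) =
      ∏ x ∈ s, phase k ^ (w x * ((f x).val : ℤ)) := by
    intro s
    induction s using Finset.induction_on with
    | empty => simp
    | insert x s hx ih => rw [Finset.sum_insert hx, Finset.prod_insert hx,
        zpow_add₀ phase_ne_zero, ih]
  rw [hz, ← Finset.prod_subset (Finset.subset_univ A)]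
  · exact Finset.prod_congr rfl fun x hx => by simp [hx, phaseDiagonal]
  · intro x _ hx
    simp [hx]

theorem unsignedRotZ_eq (A : Finset (Cube m)) :
    unsignedRotZ k A = Matrix.diagonal fun f => phase k ^ ∑ x ∈ A, 1 * ((f x).val : ℤ) := by
  rw [← tensorOp_phaseDiagonal, unsignedRotZ, onSet, rotZ_eq]

theorem signedRotZ_eq (A : Finset (Cube m)) :
    signedRotZ k A =
      Matrix.diagonal fun f => phase k ^ ∑ x ∈ A, (-1) ^ hammingNorm x * ((f x).val : ℤ) := by
  rw [← tensorOp_phaseDiagonal, signedRotZ]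
  congr 1
  funext x
  congr 1
  split_ifs with h
  · rw [h.neg_one_pow, rotZ_eq]
  · rw [(Nat.not_even_iff_odd.1 h).neg_one_pow, rotZ_conjTranspose]

theorem unsignedRotZ_equiv_signedRotZ {K : Finset (Fin m)} (hr : 1 ≤ r)
    (hK : k * r + 2 ≤ K.card) :
    LogicallyEquivalent m q r (unsignedRotZ k (stdCube K)) (signedRotZ k (stdCube K)) := by
  rw [unsignedRotZ_eq, signedRotZ_eq]
  refine logicallyEquivalent_diagonal fun f hf => ?_
  rw [phase_zpow_of_modEq (weighted_sum_modEq (isCubeWeight_one K) hf hr hK),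
    phase_zpow_of_modEq (weighted_sum_modEq (isCubeWeight_neg_one_pow K) hf hr hK)]

/-! ### The logical circuit -/

theorem controlledZCircuit_eq {ι : Type} [Fintype ι] [DecidableEq ι] (F : Finset (Finset ι)) :
    controlledZCircuit F = Matrix.diagonal fun b =>
      ∏ I ∈ F, if I.Nonempty ∧ ∀ i ∈ I, b i = 1 then (-1 : ℂ) else 1 := by
  have h := Finset.map_noncommProd F (fun I => fun b : ι → Fin 2 =>
      if I.Nonempty ∧ ∀ i ∈ I, b i = 1 then (-1 : ℂ) else 1) (fun _ _ _ _ _ => Commute.all _ _)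
    (Matrix.diagonalRingHom (ι → Fin 2) ℂ)
  rw [Finset.noncommProd_eq_prod] at h
  refine h.symm.trans ?_
  change Matrix.diagonal _ = Matrix.diagonal _
  congr 1
  funext b
  rw [Finset.prod_apply]

/-- Forgetting the degree bounds is a bijection between the two kinds of cover; it turns the parity
of monomial covers into the phase of the logical circuit. -/
theorem card_minimalCovers_filter {K : Finset (Fin m)} (hK : q + k * r + 1 ≤ K.card)
    {f : Cube m → Fin 2} (hf : f ∈ reedMuller m r) :
    ((minimalCovers m q r k K).filter fun 𝒥 =>
      𝒥.Nonempty ∧ ∀ J ∈ 𝒥, logicalBits m q r f J = 1).card = (monomialCovers k K f).card := by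
  refine Finset.card_bij (fun 𝒥 _ => 𝒥.map (Function.Embedding.subtype _)) ?_ ?_ ?_
  · intro 𝒥 h𝒥
    simp only [minimalCovers, Finset.mem_filter, Finset.mem_univ, true_and] at h𝒥
    obtain ⟨⟨hU, hc⟩, -, hb⟩ := h𝒥
    simp only [monomialCovers, Finset.mem_filter, Finset.mem_powerset, Finset.card_map, hc,
      true_and]
    refine ⟨fun J hJ => ?_, ?_⟩
    · obtain ⟨J', hJ', rfl⟩ := Finset.mem_map.1 hJ
      exact mem_monomials.2 (hb J' hJ')
    · rw [Finset.sup_map, ← hU, ← Finset.sup_eq_biUnion]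
      rfl
  · exact fun 𝒥 _ 𝒥' _ h => Finset.map_injective _ h
  · intro 𝒥 h𝒥
    simp only [monomialCovers, Finset.mem_filter, Finset.mem_powerset] at h𝒥
    obtain ⟨hs, hc, hU⟩ := h𝒥
    have hle : ∀ J ∈ 𝒥, J.card ≤ r := by
      intro J hJ
      by_contra hlt
      have h1 := mem_monomials.1 (hs hJ)
      rw [hf J (not_le.1 hlt)] at h1
      exact absurd h1 (by decide)
    -- The other `k` monomials cover at most `k * r` elements of `K`, leaving at least `q + 1` for
    -- `J`.
    have hge : ∀ J ∈ 𝒥, q + 1 ≤ J.card := by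
      intro J hJ
      have h1 : K = J ∪ (𝒥.erase J).sup id := by
        rw [← hU, ← Finset.insert_erase hJ, Finset.sup_insert, Finset.erase_insert_eq_erase,
          Finset.erase_idem]
        rfl
      have h2 := card_sup_le hf ((Finset.erase_subset J 𝒥).trans hs)
      rw [Finset.card_erase_of_mem hJ, hc, Nat.add_sub_cancel] at h2
      have h3 := Finset.card_union_le J ((𝒥.erase J).sup id)
      rw [← h1] at h3
      omega
    have hmap : (𝒥.subtype fun J => q + 1 ≤ J.card ∧ J.card ≤ r).map
        (Function.Embedding.subtype _) = 𝒥 :=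
      Finset.subtype_map_of_mem fun J hJ => ⟨hge J hJ, hle J hJ⟩
    refine ⟨𝒥.subtype _, ?_, hmap⟩
    have hc' : (𝒥.subtype fun J => q + 1 ≤ J.card ∧ J.card ≤ r).card = k + 1 := by
      rw [← hc, ← Finset.card_map (Function.Embedding.subtype _), hmap]
    simp only [minimalCovers, Finset.mem_filter, Finset.mem_univ, true_and]
    refine ⟨⟨?_, hc'⟩, Finset.card_pos.1 (by omega), fun J hJ => ?_⟩
    · rw [← hU, ← hmap, Finset.sup_map, hmap, ← Finset.sup_eq_biUnion]
      rfl
    · exact mem_monomials.1 (hs (Finset.mem_subtype.1 hJ))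

theorem unsignedRotZ_implements {K : Finset (Fin m)} (hqr : q ≤ r) (hr : 1 ≤ r)
    (hq : 1 ≤ q) (hK : q + k * r + 1 ≤ K.card) :
    Implements m q r (unsignedRotZ k (stdCube K))
      (controlledZCircuit (minimalCovers m q r k K)) := by
  refine ⟨encoder m q r, isEncoder_encoder hqr, ?_⟩
  rw [unsignedRotZ_eq, controlledZCircuit_eq]
  refine diagonal_mul_encoder fun f hf => ?_
  -- The bound `q + k * r + 1 ≤ |K|` with `q ≥ 1` gives the `k * r + 2` that the congruence needs.
  rw [phase_zpow_of_modEq (weighted_sum_modEq (isCubeWeight_one K) hf hr (by omega)),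
    ← card_minimalCovers_filter hK hf, ← Finset.prod_const, Finset.prod_filter]

end QRM

end

theorem mainTheorem3 (m q r k : ℕ) (hqr : q ≤ r) (hrm : r ≤ m) (K : Finset (Fin m))
    (hK : K ∈ QRM.levelIndexSet m q r k) :
    (1 ≤ q →
      QRM.LogicallyEquivalent m q r
        (QRM.unsignedRotZ k (QRM.stdCube K)) (QRM.signedRotZ k (QRM.stdCube K))) ∧
    (q + k * r + 2 ≤ K.card →
      QRM.LogicallyEquivalent m q r
        (QRM.unsignedRotZ k (QRM.stdCube K)) (QRM.signedRotZ k (QRM.stdCube K))) ∧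
    (1 ≤ q →
      QRM.Implements m q r
        (QRM.unsignedRotZ k (QRM.stdCube K))
        (QRM.controlledZCircuit (QRM.minimalCovers m q r k K))) := by
  obtain ⟨h1, h2⟩ := hK
  -- For `r = 0` the two size bounds on `K` contradict each other.
  have hr : 1 ≤ r := by
    rcases Nat.eq_zero_or_pos r with rfl | h
    · omega
    · exact h
  exact ⟨fun hq => QRM.unsignedRotZ_equiv_signedRotZ hr (by omega),
    fun h => QRM.unsignedRotZ_equiv_signedRotZ hr (by omega),
    fun hq => QRM.unsignedRotZ_implements hqr hr hq h1⟩
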